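/- A problem is a partial multifunction $f :\subseteq \mathbb{N}^\mathbb{N} \rightrightarrows \mathbb{N}^\mathbb{N}$. For problems $f,g$ write $g \leq_\mathrm{W} f$ if there are computable partial functionals $H, K :\subseteq \mathbb{N}^\mathbb{N} \to \mathbb{N}^\mathbb{N}$ such that $K\langle FH, \mathrm{id}\rangle$ is a realizer of $g$ for every realizer $F$ of $f$; $\equiv_\mathrm{W}$, $<_\mathrm{W}$ and incomparability are derived from $\leq_\mathrm{W}$. Let $f \times g$ be the parallel product and $f^*$ the finite parallelization (any finite number of instances of $f$ in parallel, the number being part of the input). Consider the following problems, with the usual encodings of inputs and outputs as elements of $\mathbb{N}^\mathbb{N}$. - $\mathsf{C}_\mathbb{N}$: given an enumeration of a set $A \subsetneq \mathbb{N}$, find some $n \notin A$. - $\mathsf{TC}_\mathbb{N}$: given an enumeration of a set $A \subseteq \mathbb{N}$, find an $n \in \mathbb{N}$ such that $n \notin A$ or $A = \mathbb{N}$. - $\mathsf{LPO}'$: given a sequence $(p_i)_{i\in\mathbb{N}}$ of infinite binary strings such that $p(i) = \lim_{s\to\infty} p_i(s)$ exists for every $i$, output $0$ if $p = 0^\mathbb{N}$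 and $1$ otherwise. - $\mathsf{IsFinite}_\mathbb{S}$: given $p \in 2^\mathbb{N}$, output $\top$ if $p$ contains only finitely many $1$s and $\bot$ otherwise, where $\top,\bot$ are the points of the Sierpinski space $\mathbb{S}$; $\top$ is named by the infinite binary strings that contain at least one $1$, and $\bot$ by $0^\mathbb{N}$. - $\mathsf{ECT}$: given $n \in \mathbb{N}$ and $f : \mathbb{N} \to \{0,\dots,n-1\}$, find a $b \in \mathbb{N}$ such that $\forall x > b\ \exists y > x\ f(x) = f(y)$. Then $(\mathsf{LPO}')^*$ and $\mathsf{TC}_\mathbb{N}^*$ are Weihrauch incomparable. More precisely, $\mathsf{C}_\mathbb{N} \not\leq_\mathrm{W} (\mathsf{LPO}')^*$ and $\mathsf{IsFinite}_\mathbb{S} \not\leq_\mathrm{W} \mathsf{ECT}$, where $\mathsf{ECT} \equiv_\mathrm{W} \mathsf{TC}_\mathbb{N}^*$. Hence $$(\mathsf{LPO}')^* <_\mathrm{W} (\mathsf{LPO}')^* \times \mathsf{TC}_\mathbb{N}^* \quad\text{and}\quad \mathsf{TC}_\mathbb{N}^* <_\mathrm{W} (\mathsf{LPO}')^* \times \mathsf{TC}_\mathbb{N}^*.$$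 -/

import Mathlib

namespace Weihrauch

/-- Baire space. Its elements serve as names of the objects that problems are about. -/
abbrev Baire : Type := ℕ → ℕ

/-- The prefix `p 0, …, p (k - 1)` of length `k` of `p`. -/
def pre (p : Baire) (k : ℕ) : List ℕ := (List.range k).map p

/-- `F` is a computable partial functional on Baire space: there is an algorithm `φ` which, given a
finite prefix `w` of the input and `n`, either announces a value for the `n`-th entry of the output
or declares (by `none`) that it needs a longer prefix. For every `p` in the domain of `F` and every
`n`, some prefix of `p` makes `φ` announce a value, and every announced value is `F(p)(n)`.
Nothing is asked of `φ` outside the domain of `F`. -/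
def ComputableFunctional (F : Baire →. Baire) : Prop :=
  ∃ φ : List ℕ → ℕ → Option ℕ, Computable₂ φ ∧
    ∀ p : Baire, ∀ y ∈ F p, ∀ n : ℕ,
      (∃ k, φ (pre p k) n = some (y n)) ∧
      ∀ k m, φ (pre p k) n = some m → m = y n

/-- The standard pairing on Baire space: `p` on even positions, `q` on odd positions. -/
def pairing (p q : Baire) : Baire := fun n => if n % 2 = 0 then p (n / 2) else q (n / 2)

def fstPart (r : Baire) : Baire := fun n => r (2 * n)

def sndPart (r : Baire) : Baire := fun n => r (2 * n + 1)

/-- A problem is a partial multifunction on Baire space: `f p` is the set of (names of) solutions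
of the instance (named by) `p`; it is empty exactly when `p` is not in the domain of `f`. -/
abbrev Problem : Type := Baire → Set Baire

namespace Problem

def dom (f : Problem) : Set Baire := {p | (f p).Nonempty}

/-- The partial function `F` is a realizer of `f`: for all `p` in the domain of `f`, the value
`F p` is defined and lies in `f p`. -/
def Realizes (F : Baire →. Baire) (f : Problem) : Prop :=
  ∀ p ∈ f.dom, ∃ y ∈ F p, y ∈ f p

/-- The partial function `K⟨FH, id⟩`. -/
def compose (K F H : Baire →. Baire) : Baire →. Baire := fun p =>
  (H p).bind fun h => (F h).bind fun y => K (pairing y p)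

/-- Weihrauch reducibility `g ≤_W f`. -/
def Reducible (g f : Problem) : Prop :=
  ∃ H K : Baire →. Baire, ComputableFunctional H ∧ ComputableFunctional K ∧
    ∀ F : Baire →. Baire, Realizes F f → Realizes (compose K F H) g

/-- Weihrauch equivalence. -/
def Equivalent (f g : Problem) : Prop := Reducible f g ∧ Reducible g f

/-- Strict Weihrauch reducibility `f <_W g`. -/
def StrictlyBelow (f g : Problem) : Prop := Reducible f g ∧ ¬ Reducible g f

/-- Weihrauch incomparability. -/
def Incomparable (f g : Problem) : Prop := ¬ Reducible f g ∧ ¬ Reducible g f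

/-- The parallel product `f × g`; the pair of `p` and `q` is named by `pairing p q`. -/
def prod (f g : Problem) : Problem := fun r =>
  {s | fstPart s ∈ f (fstPart r) ∧ sndPart s ∈ g (sndPart r)}

/-- The `i`-th component of the tuple named by `p`, where a name of a tuple of length `n` is a `p`
with `p 0 = n` which lists the entry `k` of the component `i < n` at the position
`Nat.pair i k + 1`. -/
def component (p : Baire) (i : ℕ) : Baire := fun k => p (Nat.pair i k + 1)

/-- The finite parallelization `f^*`: an instance is a tuple of instances of `f` of any finite
length (which is part of the input); a solution is a tuple of solutions of the same length. -/
def finPar (f : Problem) : Problem := fun p =>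
  {q | q 0 = p 0 ∧ ∀ i < p 0, component q i ∈ f (component p i)}

end Problem

open Problem

/-- The set enumerated by `e`. An enumeration may list nothing at a step (entry `0`); the entry
`n + 1` lists `n`. In particular the empty set has an enumeration. -/
def enumerated (e : Baire) : Set ℕ := {n | ∃ k, e k = n + 1}

/-- Closed choice on `ℕ`. A natural number `n` is named by every `q` with `q 0 = n`. -/
def CN : Problem := fun e => {q | q 0 ∉ enumerated e}

/-- The totalization of closed choice on `ℕ`. -/
def TCN : Problem := fun e => {q | q 0 ∉ enumerated e ∨ enumerated e = Set.univ}

/-- `p` is an element of Cantor space. -/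
def IsBinary (p : Baire) : Prop := ∀ k, p k < 2

/-- The limited principle of omniscience: `0` if `p` is the zero sequence and `1` otherwise. -/
def LPO : Problem := fun p =>
  {q | IsBinary p ∧ ((p = 0 ∧ q 0 = 0) ∨ (p ≠ 0 ∧ q 0 = 1))}

/-- The jump of `LPO`: an instance is a sequence of binary sequences, the `i`-th of which is
`s ↦ p (Nat.pair i s)`, all of which converge; the solution is that of `LPO` for the sequence of
the limits. -/
def LPOJump : Problem := fun p =>
  {q | IsBinary p ∧ ∃ l : Baire,
    (∀ i, Filter.Tendsto (fun s => p (Nat.pair i s)) Filter.atTop (nhds (l i))) ∧ q ∈ LPO l}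

/-- Does the binary sequence `p` have only finitely many ones? The answer lies in the Sierpinski
space, whose point `⊤` is named by the binary sequences that contain a `1`, and whose point `⊥` is
named by the zero sequence. -/
def IsFiniteS : Problem := fun p =>
  {q | IsBinary p ∧ IsBinary q ∧ ((∃ k, q k = 1) ↔ {k | p k = 1}.Finite)}

/-- Eventually constant palette tail. An instance `(n, f)`, with `f : ℕ → {0, …, n - 1}`, is named
by the sequence `n, f 0, f 1, …`; the solutions are the numbers `b` such that every colour which
occurs after `b` occurs again later on. -/
def ECT : Problem := fun p =>
  {q | (∀ k, p (k + 1) < p 0) ∧ ∀ x > q 0, ∃ y > x, p (x + 1) = p (y + 1)}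

end Weihrauch

namespace Weihrauch

open Problem PiNat

/-! Both non-reductions hold for topological reasons. Computable functionals are continuous, so
`Reducible` implies the transitive relation `TopReducible`, and it is the latter that is refuted.

For `CN` against `finPar LPOJump`: a finite prefix of the instance fixes the number n of components,
so up to irrelevant entries there are at most 2^n answer tuples. For each tuple that can still be a
solution, a longer prefix commits the reverse functional to one number. The enumeration then
continues by listing all these finitely many numbers, which makes every possible output wrong
(`not_topReducible_CN_finPar`).

For `IsFiniteS` against `ECT`: a prefix fixes the number n of colours. If every colour not yet dead
could be made to recur in every smaller cylinder, let the functional answer "finite" on a sequence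
ending in zeros, and then extend the relevant prefix to a sequence with infinitely many ones along
which all live colours recur. The same bound remains correct, so the answer stays "finite", which is
false. Hence some cylinder kills one more colour (`exists_new_dead_colour`), and n + 1 rounds
exhaust the palette.

The remaining statements follow from explicit reductions: `CN` to `finPar TCN`, `IsFiniteS` to
`finPar LPOJump`, and both directions between `ECT` and `finPar TCN`. The product lies above both
factors, so it reduces to neither, as the factors are incomparable. -/

/-! ### Continuity on Baire space -/

theorem pre_eq_pre_iff {p q : Baire} {k : ℕ} : pre p k = pre q k ↔ p ∈ cylinder q k := by
  simp [pre, List.map_inj_left, mem_cylinder_iff]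

/-- A function is continuous on `S` as soon as each entry of its values is determined, within `S`,
by a finite prefix of the argument. -/
theorem continuousOn_of_cylinder {S : Set Baire} {F : Baire → Baire}
    (h : ∀ p ∈ S, ∀ n, ∃ k, ∀ q ∈ S, q ∈ cylinder p k → F q n = F p n) : ContinuousOn F S := by
  rw [continuousOn_pi]
  intro n p hp
  obtain ⟨k, hk⟩ := h p hp n
  have hmem : cylinder p k ∈ nhdsWithin p S :=
    mem_nhdsWithin_of_mem_nhds ((isOpen_cylinder _ p k).mem_nhds (self_mem_cylinder p k))
  refine tendsto_nhds_of_eventually_eq ?_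
  filter_upwards [hmem, self_mem_nhdsWithin] with q hq hqS using hk q hqS hq

theorem exists_cylinder_subset {S : Set Baire} {p : Baire} (h : S ∈ nhds p) :
    ∃ k, cylinder p k ⊆ S := by
  obtain ⟨U, hU, hUo, hpU⟩ := mem_nhds_iff.1 h
  obtain ⟨_, ⟨x, n, rfl⟩, hp, hs⟩ :=
    (isTopologicalBasis_cylinders (fun _ : ℕ => ℕ)).exists_subset_of_mem_open hpU hUo
  exact ⟨n, (mem_cylinder_iff_eq.1 hp).le.trans (hs.trans hU)⟩

/-- Each entry of the value of a continuous function is determined by a finite prefix. -/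
theorem exists_cylinder_of_continuousOn {S : Set Baire} {F : Baire → Baire}
    (h : ContinuousOn F S) {p : Baire} (hp : p ∈ S) (n : ℕ) :
    ∃ k, ∀ q ∈ S, q ∈ cylinder p k → F q n = F p n := by
  have h1 := (continuousOn_pi.1 h n) p hp
  have h2 : ∀ᶠ q in nhdsWithin p S, F q n = F p n :=
    h1 ((isOpen_discrete {F p n}).mem_nhds rfl)
  obtain ⟨U, hU, hUS⟩ := mem_nhdsWithin_iff_exists_mem_nhds_inter.1 h2
  obtain ⟨k, hk⟩ := exists_cylinder_subset hU
  exact ⟨k, fun q hq hqk => hUS ⟨hk hqk, hq⟩⟩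

/-- An announced value depends only on the prefix read so far. The non-reductions use nothing else
about computability. -/
theorem ComputableFunctional.continuousOn {F : Baire →. Baire} (hF : ComputableFunctional F)
    {S : Set Baire} {G : Baire → Baire} (hG : ∀ p ∈ S, G p ∈ F p) : ContinuousOn G S := by
  obtain ⟨φ, -, h⟩ := hF
  refine continuousOn_of_cylinder fun p hp n => ?_
  obtain ⟨k, hk⟩ := (h p _ (hG p hp) n).1
  refine ⟨k, fun q hq hqk => ?_⟩
  rw [← pre_eq_pre_iff.2 hqk] at hk
  exact ((h q _ (hG q hq) n).2 _ _ hk).symm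

theorem continuous_pairing : Continuous fun r : Baire × Baire => pairing r.1 r.2 := by
  refine continuous_pi fun n => ?_
  by_cases h : n % 2 = 0 <;> simp only [pairing, h, if_true, if_false] <;> fun_prop

@[simp] theorem fstPart_pairing (p q : Baire) : fstPart (pairing p q) = p := by
  funext n; simp [fstPart, pairing]

@[simp] theorem sndPart_pairing (p q : Baire) : sndPart (pairing p q) = q := by
  funext n
  have : (2 * n + 1) / 2 = n := by omega
  simp [sndPart, pairing, this, Nat.add_mod]

theorem continuous_fstPart : Continuous fstPart :=
  continuous_pi fun n => continuous_apply (2 * n)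

theorem continuous_sndPart : Continuous sndPart :=
  continuous_pi fun n => continuous_apply (2 * n + 1)

/-! ### Topological Weihrauch reducibility -/

namespace Problem

/-- The names of pairs of a solution of `f` at `H p` and an instance `p` of `g`. -/
def answerSet (g f : Problem) (H : Baire → Baire) : Set Baire :=
  {r | sndPart r ∈ g.dom ∧ fstPart r ∈ f (H (sndPart r))}

/-- The topological version of Weihrauch reducibility. -/
def TopReducible (g f : Problem) : Prop :=
  ∃ H K : Baire → Baire, ContinuousOn H g.dom ∧ ContinuousOn K (answerSet g f H) ∧
    (∀ p ∈ g.dom, H p ∈ f.dom) ∧ ∀ p ∈ g.dom, ∀ y ∈ f (H p), K (pairing y p) ∈ g p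

/-- Quantifying over realizers amounts to quantifying over solutions, since a realizer may be
altered at a single instance to return any prescribed solution there. -/
theorem Reducible.topReducible {g f : Problem} (h : Reducible g f) : TopReducible g f := by
  classical
  obtain ⟨H, K, hH, hK, hF⟩ := h
  -- Undefined off `f.dom`, so that definedness of the composition forces the value of `H` into
  -- `f.dom`.
  let R (y : Baire → Baire) : Baire →. Baire := fun p => ⟨p ∈ f.dom, fun _ => y p⟩
  have key (y : Baire → Baire) (hy : ∀ p ∈ f.dom, y p ∈ f p) (p) (hp : p ∈ g.dom) :
      ∃ x ∈ H p, x ∈ f.dom ∧ ∃ z ∈ K (pairing (y x) p), z ∈ g p := by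
    obtain ⟨z, hz, hzg⟩ := hF (R y) (fun q hq => ⟨y q, ⟨hq, rfl⟩, hy q hq⟩) p hp
    obtain ⟨x, hx, hz⟩ := Part.mem_bind_iff.1 hz
    obtain ⟨_, ⟨hxd, rfl⟩, hz⟩ := Part.mem_bind_iff.1 hz
    exact ⟨x, hx, hxd, z, hz, hzg⟩
  have hsol : ∃ y : Baire → Baire, ∀ p ∈ f.dom, y p ∈ f p :=
    ⟨fun p => if hp : p ∈ f.dom then hp.some else p, fun p hp => by
      simpa [hp] using hp.some_mem⟩
  obtain ⟨y₀, hy₀⟩ := hsol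
  have hex : ∀ p, ∃ x, p ∈ g.dom → x ∈ H p ∧ x ∈ f.dom := fun p => by
    by_cases hp : p ∈ g.dom
    · obtain ⟨x, hx, hxd, -⟩ := key y₀ hy₀ p hp
      exact ⟨x, fun _ => ⟨hx, hxd⟩⟩
    · exact ⟨p, fun h => (hp h).elim⟩
  choose H' hH' using hex
  have hexK : ∀ r, ∃ z, sndPart r ∈ g.dom → fstPart r ∈ f (H' (sndPart r)) →
      z ∈ K (pairing (fstPart r) (sndPart r)) ∧ z ∈ g (sndPart r) := fun r => by
    by_cases hr : sndPart r ∈ g.dom ∧ fstPart r ∈ f (H' (sndPart r))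
    · obtain ⟨x, hx, -, z, hz, hzg⟩ := key
        (Function.update y₀ (H' (sndPart r)) (fstPart r)) (fun q hq => by
          by_cases hqx : q = H' (sndPart r)
          · subst hqx; simpa using hr.2
          · simpa [hqx] using hy₀ q hq) _ hr.1
      obtain rfl := Part.mem_unique hx (hH' _ hr.1).1
      rw [Function.update_self] at hz
      exact ⟨z, fun _ _ => ⟨hz, hzg⟩⟩
    · exact ⟨r, fun h1 h2 => (hr ⟨h1, h2⟩).elim⟩
  choose K' hK' using hexK
  refine ⟨H', K', hH.continuousOn fun p hp => (hH' p hp).1, hK.continuousOn fun r hr => ?_,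
    fun p hp => (hH' p hp).2, fun p hp y hy => ?_⟩
  · have hr' : pairing (fstPart r) (sndPart r) = r := by
      funext n
      rcases Nat.even_or_odd' n with ⟨m, rfl | rfl⟩
      · simp [pairing, fstPart]
      · have : (2 * m + 1) / 2 = m := by omega
        simp [pairing, sndPart, this, Nat.add_mod]
    have := (hK' r hr.1 hr.2).1
    rwa [hr'] at this
  · simpa [hp, hy] using (hK' (pairing y p) (by simpa) (by simpa)).2

theorem TopReducible.trans {h g f : Problem} (hg : TopReducible h g) (gf : TopReducible g f) :
    TopReducible h f := by
  obtain ⟨H₁, K₁, cH₁, cK₁, d₁, s₁⟩ := hg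
  obtain ⟨H₂, K₂, cH₂, cK₂, d₂, s₂⟩ := gf
  refine ⟨H₂ ∘ H₁, fun r => K₁ (pairing (K₂ (pairing (fstPart r) (H₁ (sndPart r)))) (sndPart r)),
    cH₂.comp cH₁ d₁, ?_, fun p hp => d₂ _ (d₁ p hp), fun p hp y hy => ?_⟩
  · have c1 : ContinuousOn (fun r => H₁ (sndPart r)) (answerSet h f (H₂ ∘ H₁)) :=
      cH₁.comp continuous_sndPart.continuousOn fun r hr => hr.1
    have c2 : ContinuousOn (fun r => K₂ (pairing (fstPart r) (H₁ (sndPart r))))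
        (answerSet h f (H₂ ∘ H₁)) :=
      cK₂.comp (continuous_pairing.comp_continuousOn
        (continuous_fstPart.continuousOn.prodMk c1)) fun r hr =>
          ⟨by simpa using d₁ _ hr.1, by simpa using hr.2⟩
    exact cK₁.comp (continuous_pairing.comp_continuousOn
      (c2.prodMk continuous_sndPart.continuousOn)) fun r hr =>
        ⟨by simpa using hr.1, by simpa using s₂ _ (d₁ _ hr.1) _ hr.2⟩
  · simpa using s₁ p hp _ (s₂ _ (d₁ p hp) y hy)

/-- The reverse functional of a topological reduction decides each entry from finite prefixes of
the instance, uniformly in all instances with the same solution. -/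
theorem exists_cylinder_of_answerSet {g f : Problem} {H K : Baire → Baire}
    (cK : ContinuousOn K (answerSet g f H)) {y p : Baire} (hp : p ∈ g.dom) (hy : y ∈ f (H p))
    (n : ℕ) : ∃ k, ∀ q ∈ g.dom, q ∈ cylinder p k → y ∈ f (H q) →
      K (pairing y q) n = K (pairing y p) n := by
  obtain ⟨k, hk⟩ := exists_cylinder_of_continuousOn
    (F := fun q => K (pairing y q)) (S := {q | q ∈ g.dom ∧ y ∈ f (H q)})
    (cK.comp (continuous_pairing.comp (by fun_prop : Continuous fun q => (y, q))).continuousOn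
      fun q hq => ⟨by simpa using hq.1, by simpa using hq.2⟩) ⟨hp, hy⟩ n
  exact ⟨k, fun q h1 h2 h3 => hk q ⟨h1, h3⟩ h2⟩

end Problem

/-! ### Closed choice does not reduce to finitely many yes/no answers -/

namespace Problem

/-- The tuple of length `n` with components `c 0, …, c (n - 1)`. -/
def tuple (n : ℕ) (c : ℕ → Baire) : Baire := fun x =>
  if x = 0 then n else c (x - 1).unpair.1 (x - 1).unpair.2

@[simp] theorem tuple_zero (n : ℕ) (c : ℕ → Baire) : tuple n c 0 = n := rfl

@[simp] theorem component_tuple (n : ℕ) (c : ℕ → Baire) (i : ℕ) : component (tuple n c) i = c i := by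
  funext k; simp [component, tuple]

/-- Closed choice on `ℕ` is not reducible to the finite parallelization of a problem with the
answers `0` and `1`, not even topologically. -/
theorem not_topReducible_CN_finPar {f : Problem}
    (hf : ∀ p ∈ f.dom, ∃ c : Bool, ∀ q : Baire, q 0 = c.toNat → q ∈ f p) :
    ¬ TopReducible CN (finPar f) := by
  classical
  rintro ⟨H, K, cH, cK, hd, hs⟩
  have dom_of_finite (e : Baire) (he : (enumerated e).Finite) : e ∈ CN.dom := by
    obtain ⟨n, hn⟩ := he.exists_notMem
    exact ⟨fun _ => n, hn⟩
  have h0 : (0 : Baire) ∈ CN.dom := dom_of_finite _ (by simp [enumerated])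
  obtain ⟨k₀, hk₀⟩ := exists_cylinder_of_continuousOn cH h0 0
  set n := H 0 0
  -- The subset `a` of the n components records which of them are answered `1`.
  let sol (a : Finset ℕ) : Baire := tuple n fun i _ => (decide (i ∈ a)).toNat
  have exists_sol (e : Baire) (he : e ∈ CN.dom) (hek : e ∈ cylinder 0 k₀) :
      ∃ a ∈ (Finset.range n).powerset, sol a ∈ finPar f (H e) := by
    obtain ⟨y, -, hy⟩ := hd e he
    have hn : H e 0 = n := hk₀ e he hek
    have : ∀ i, ∃ c : Bool, i < n → ∀ q : Baire, q 0 = c.toNat → q ∈ f (component (H e) i) :=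
      fun i => by
        by_cases hi : i < n
        · obtain ⟨c, hc⟩ := hf _ ⟨_, hy i (hn ▸ hi)⟩
          exact ⟨c, fun _ => hc⟩
        · exact ⟨true, fun h => (hi h).elim⟩
    choose c hc using this
    refine ⟨(Finset.range n).filter fun i => c i = true, by simp, ?_, fun i hi => ?_⟩
    · simp [sol, hn]
    · rw [hn] at hi
      refine hc i hi _ ?_
      simp [sol, hi]
  -- Treat the tuples one at a time: either no instance in the current cylinder has `sol a` as a
  -- solution, or shrinking the cylinder freezes the output for `sol a`, and that number joins `V`.
  have main (T : Finset (Finset ℕ)) : ∃ (e : Baire) (k : ℕ) (V : Finset ℕ),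
      cylinder e k ⊆ cylinder 0 k₀ ∧ ∀ a ∈ T, ∀ e' ∈ CN.dom, e' ∈ cylinder e k →
        sol a ∈ finPar f (H e') → K (pairing (sol a) e') 0 ∈ V := by
    induction T using Finset.induction_on with
    | empty => exact ⟨0, k₀, ∅, subset_rfl, by simp⟩
    | insert a T _ ih =>
      obtain ⟨e, k, V, hsub, hV⟩ := ih
      by_cases hex : ∃ e' ∈ CN.dom, e' ∈ cylinder e k ∧ sol a ∈ finPar f (H e')
      · obtain ⟨e', hd', he', hsol⟩ := hex
        obtain ⟨k', hk'⟩ := exists_cylinder_of_answerSet cK hd' hsol 0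
        have hsub' : cylinder e' (max k k') ⊆ cylinder e k :=
          (cylinder_anti e' (le_max_left _ _)).trans (mem_cylinder_iff_eq.1 he').le
        refine ⟨e', max k k', insert (K (pairing (sol a) e') 0) V, hsub'.trans hsub, ?_⟩
        intro a' ha' e'' hd'' he'' hsol''
        rcases Finset.mem_insert.1 ha' with rfl | ha'
        · rw [hk' e'' hd'' (cylinder_anti e' (le_max_right _ _) he'') hsol'']
          exact Finset.mem_insert_self _ _
        · exact Finset.mem_insert_of_mem (hV a' ha' e'' hd'' (hsub' he'') hsol'')
      · refine ⟨e, k, V, hsub, fun a' ha' e' hd' he' hsol => ?_⟩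
        rcases Finset.mem_insert.1 ha' with rfl | ha'
        · exact (hex ⟨e', hd', he', hsol⟩).elim
        · exact hV a' ha' e' hd' he' hsol
  obtain ⟨e, k, V, hsub, hV⟩ := main (Finset.range n).powerset
  -- Keep the prefix, then list exactly `V`: the element `v` is listed at position `v + k`. The
  -- enumerated set stays finite, so this is an instance of `CN`.
  let e' : Baire := fun j => if j < k then e j else if j - k ∈ V then j - k + 1 else 0
  have hmem : e' ∈ cylinder e k := mem_cylinder_iff.2 fun i hi => by simp [e', hi]
  have hdom : e' ∈ CN.dom := by
    refine dom_of_finite _ (((Finset.range k).image (fun j => e j - 1) ∪ V).finite_toSet.subset ?_)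
    rintro m ⟨j, hj⟩
    simp only [Finset.coe_union, Finset.coe_image, Set.mem_union, Set.mem_image, Finset.mem_coe,
      Finset.mem_range]
    by_cases hjk : j < k
    · exact Or.inl ⟨j, hjk, by simp [e', hjk] at hj; omega⟩
    · by_cases hjV : j - k ∈ V
      · simp only [e', hjk, hjV, if_true, if_false] at hj
        exact Or.inr (by rwa [show m = j - k by omega])
      · simp [e', hjk, hjV] at hj
  obtain ⟨a, ha, hsol⟩ := exists_sol e' hdom (hsub hmem)
  refine hs e' hdom _ hsol ⟨K (pairing (sol a) e') 0 + k, ?_⟩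
  simp [e', hV a ha e' hdom hmem hsol]

end Problem

/-! ### Finiteness of the set of ones does not reduce to `ECT` -/

theorem exists_mem_cylinder_of_chain (p : ℕ → Baire) (k : ℕ → ℕ) (hk : StrictMono k)
    (hp : ∀ j, p (j + 1) ∈ cylinder (p j) (k j)) : ∃ P, ∀ j, P ∈ cylinder (p j) (k j) := by
  have step (j l : ℕ) (hjl : j ≤ l) : p l ∈ cylinder (p j) (k j) := by
    induction l, hjl using Nat.le_induction with
    | base => exact self_mem_cylinder _ _
    | succ l hjl ih =>
      rw [← mem_cylinder_iff_eq.1 ih]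
      exact cylinder_anti _ (hk.monotone hjl) (hp l)
  refine ⟨fun i => p (i + 1) i, fun j => mem_cylinder_iff.2 fun i hi => ?_⟩
  rcases le_total (i + 1) j with h | h
  · exact (mem_cylinder_iff.1 (step _ _ h) i ((hk.id_le _).trans_lt' (Nat.lt_succ_self i))).symm
  · exact mem_cylinder_iff.1 (step _ _ h) i hi

theorem mem_dom_isFiniteS {p : Baire} : p ∈ IsFiniteS.dom ↔ IsBinary p := by
  classical
  refine ⟨fun ⟨_, h, _⟩ => h, fun h => ?_⟩
  by_cases hf : {k | p k = 1}.Finite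
  · exact ⟨fun _ => 1, h, fun _ => by norm_num, by simpa using hf⟩
  · exact ⟨fun _ => 0, h, fun _ => by norm_num, by simpa using hf⟩

theorem ect_mono {p q q' : Baire} (h : q ∈ ECT p) (hq : q 0 ≤ q' 0) : q' ∈ ECT p :=
  ⟨h.1, fun x hx => h.2 x (hq.trans_lt hx)⟩

namespace Problem

/-- If the colours of `D` do not occur after `d` in the images of the binary sequences in a
cylinder, then in a smaller cylinder the same can be said of one more colour. -/
theorem exists_new_dead_colour {H K : Baire → Baire} (cH : ContinuousOn H IsFiniteS.dom)
    (cK : ContinuousOn K (answerSet IsFiniteS ECT H)) (hd : ∀ p ∈ IsFiniteS.dom, H p ∈ ECT.dom)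
    (hs : ∀ p ∈ IsFiniteS.dom, ∀ y ∈ ECT (H p), K (pairing y p) ∈ IsFiniteS p)
    {n : ℕ} {D : Finset ℕ} {p : Baire} {k d : ℕ} (hp : IsBinary p)
    (hn : ∀ q, IsBinary q → q ∈ cylinder p k → H q 0 = n)
    (hD : ∀ q, IsBinary q → q ∈ cylinder p k → ∀ x > d, H q (x + 1) ∉ D) :
    ∃ c < n, c ∉ D ∧ ∃ (p' : Baire) (k' d' : ℕ), IsBinary p' ∧ cylinder p' k' ⊆ cylinder p k ∧
      ∀ q, IsBinary q → q ∈ cylinder p' k' → ∀ x > d', H q (x + 1) ∉ insert c D := by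
  classical
  by_contra! hcon
  -- Passing to `max d d'` rules out the colours of `D`, so the late colour found must be `c`
  -- itself.
  have recur (c : ℕ) (hc : c < n) (hcD : c ∉ D) (p' : Baire) (k' d' : ℕ) (hp' : IsBinary p')
      (hsub : cylinder p' k' ⊆ cylinder p k) :
      ∃ q, IsBinary q ∧ q ∈ cylinder p' k' ∧ ∃ x > d', H q (x + 1) = c := by
    obtain ⟨q, hq, hqp, x, hx, hxc⟩ := hcon c hc hcD p' k' (max d d') hp' hsub
    rcases Finset.mem_insert.1 hxc with h | h
    · exact ⟨q, hq, hqp, x, (le_max_right _ _).trans_lt hx, h⟩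
    · exact (hD q hq (hsub hqp) x ((le_max_left _ _).trans_lt hx) h).elim
  let p₀ : Baire := fun i => if i < k then p i else 0
  have hp₀ : IsBinary p₀ := fun i => by
    by_cases hi : i < k <;> simp [p₀, hi, hp i]
  have hp₀k : p₀ ∈ cylinder p k := mem_cylinder_iff.2 fun i hi => by simp [p₀, hi]
  have hfin : {i | p₀ i = 1}.Finite := (Set.finite_lt_nat k).subset fun i hi => by
    by_contra h
    have h' : ¬ i < k := h
    simp [p₀, h'] at hi
  obtain ⟨y₀, hy₀⟩ := hd p₀ (mem_dom_isFiniteS.2 hp₀)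
  -- Raising the bound to at least `d` ensures that only live colours matter to it. This makes it
  -- reusable for the limit `P`.
  let y : Baire := fun _ => max (y₀ 0) d
  have hy : y ∈ ECT (H p₀) := ect_mono hy₀ (le_max_left _ _)
  obtain ⟨m, hm⟩ := (hs p₀ (mem_dom_isFiniteS.2 hp₀) y hy).2.2.2 hfin
  obtain ⟨k₁, hk₁⟩ := exists_cylinder_of_answerSet cK (mem_dom_isFiniteS.2 hp₀) hy m
  let S := {s : Baire × ℕ // IsBinary s.1 ∧ cylinder s.1 s.2 ⊆ cylinder p₀ (max k k₁)}
  have hS : cylinder p₀ (max k k₁) ⊆ cylinder p k :=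
    (cylinder_anti _ (le_max_left _ _)).trans (mem_cylinder_iff_eq.1 hp₀k).le
  -- Each extension appends a one and, if `c` is live, forces a new occurrence of `c` at a position
  -- no smaller than the old prefix length.
  have step (s : S) (c : ℕ) : ∃ t : S, s.1.2 < t.1.2 ∧ t.1.1 ∈ cylinder s.1.1 s.1.2 ∧
      (∃ i ≥ s.1.2, i < t.1.2 ∧ t.1.1 i = 1) ∧
      (c < n → c ∉ D → ∃ x ≥ s.1.2, ∀ q, IsBinary q → q ∈ cylinder t.1.1 t.1.2 →
        H q (x + 1) = c) := by
    obtain ⟨⟨p', k'⟩, hp', hsub⟩ := s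
    dsimp only at hp' hsub ⊢
    let q := Function.update p' k' 1
    have hq : IsBinary q := fun i => by
      by_cases hi : i = k'
      · subst hi; simp [q]
      · simpa [q, hi] using hp' i
    have hqc : cylinder q (k' + 1) ⊆ cylinder p' k' :=
      (cylinder_anti _ (Nat.le_succ _)).trans
        (mem_cylinder_iff_eq.1 (update_mem_cylinder p' k' 1)).le
    by_cases hc : c < n ∧ c ∉ D
    · obtain ⟨r, hr, hrq, x, hx, hxc⟩ :=
        recur c hc.1 hc.2 q (k' + 1) k' hq (hqc.trans (hsub.trans hS))
      obtain ⟨k₃, hk₃⟩ := exists_cylinder_of_continuousOn cH (mem_dom_isFiniteS.2 hr) (x + 1)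
      refine ⟨⟨⟨r, max (k' + 1) k₃⟩, hr, ?_⟩, lt_max_of_lt_left (Nat.lt_succ_self _), hqc hrq,
        ⟨k', le_rfl, lt_max_of_lt_left (Nat.lt_succ_self _), ?_⟩,
        fun _ _ => ⟨x, hx.le, fun t ht htr => ?_⟩⟩
      · exact (cylinder_anti _ (le_max_left _ _)).trans
          ((mem_cylinder_iff_eq.1 hrq).le.trans (hqc.trans hsub))
      · have := mem_cylinder_iff.1 hrq k' (Nat.lt_succ_self _)
        simpa [q] using this
      · rw [hk₃ t (mem_dom_isFiniteS.2 ht) (cylinder_anti _ (le_max_right _ _) htr), hxc]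
    · exact ⟨⟨⟨q, k' + 1⟩, hq, hqc.trans hsub⟩, Nat.lt_succ_self _, hqc (self_mem_cylinder _ _),
        ⟨k', le_rfl, Nat.lt_succ_self _, by simp [q]⟩, fun h1 h2 => (hc ⟨h1, h2⟩).elim⟩
  choose next hlt hcyl hone hcol using step
  -- Scheduling by `j.unpair.1` serves every colour infinitely often.
  let seq : ℕ → S := fun j =>
    j.rec ⟨⟨p₀, max k k₁⟩, hp₀, subset_rfl⟩ fun j s => next s j.unpair.1
  have hmono : StrictMono fun j => (seq j).1.2 := strictMono_nat_of_lt_succ fun j => hlt _ _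
  obtain ⟨P, hP⟩ := exists_mem_cylinder_of_chain (fun j => (seq j).1.1) (fun j => (seq j).1.2)
    hmono fun j => hcyl _ _
  have hPb : IsBinary P := fun i => by
    rw [mem_cylinder_iff.1 (hP (i + 1)) i ((hmono.id_le (i + 1)).trans_lt' (Nat.lt_succ_self i))]
    exact (seq (i + 1)).2.1 i
  have hP₀ : P ∈ cylinder p₀ (max k k₁) := hP 0
  have hPinf : ¬ {i | P i = 1}.Finite := by
    refine Set.infinite_of_forall_exists_gt fun j => ?_
    obtain ⟨i, hi, hi', h1⟩ := hone (seq (j + 1)) (j + 1).unpair.1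
    exact ⟨i, (mem_cylinder_iff.1 (hP (j + 2)) i hi').trans h1,
      (Nat.lt_succ_self j).trans_le ((hmono.id_le (j + 1)).trans hi)⟩
  have hPn : H P 0 = n := hn P hPb (hS hP₀)
  have hPy : y ∈ ECT (H P) := by
    obtain ⟨_, hlt, -⟩ := hd P (mem_dom_isFiniteS.2 hPb)
    refine ⟨hlt, fun x hx => ?_⟩
    have hxD := hD P hPb (hS hP₀) x ((le_max_right _ _).trans_lt hx)
    -- This stage serves the colour at `x`, and its index is at least `x + 1`, so the occurrence it
    -- forces lies beyond `x`.
    obtain ⟨x', hx', h⟩ := hcol (seq (Nat.pair (H P (x + 1)) (x + 1)))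
      (Nat.pair (H P (x + 1)) (x + 1)).unpair.1 (by simpa [hPn] using hlt x) (by simpa using hxD)
    refine ⟨x', ?_, ?_⟩
    · exact (Nat.lt_succ_self x).trans_le
        ((Nat.right_le_pair _ _).trans ((hmono.id_le _).trans hx'))
    · rw [h P hPb (hP (Nat.pair (H P (x + 1)) (x + 1) + 1)), Nat.unpair_pair]
  refine hPinf ((hs P (mem_dom_isFiniteS.2 hPb) y hPy).2.2.1 ⟨m, ?_⟩)
  rw [hk₁ P (mem_dom_isFiniteS.2 hPb) (cylinder_anti _ (le_max_right _ _) hP₀) hPy, hm]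

/-- Iterating `exists_new_dead_colour` would give more dead colours than the palette contains. -/
theorem not_topReducible_isFiniteS_ECT : ¬ TopReducible IsFiniteS ECT := by
  classical
  rintro ⟨H, K, cH, cK, hd, hs⟩
  have h0 : IsBinary 0 := fun _ => by norm_num
  obtain ⟨k₀, hk₀⟩ := exists_cylinder_of_continuousOn cH (mem_dom_isFiniteS.2 h0) 0
  have main (j : ℕ) : ∃ D ⊆ Finset.range (H 0 0), D.card = j ∧ ∃ (p : Baire) (k d : ℕ),
      IsBinary p ∧ cylinder p k ⊆ cylinder 0 k₀ ∧
      ∀ q, IsBinary q → q ∈ cylinder p k → ∀ x > d, H q (x + 1) ∉ D := by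
    induction j with
    | zero => exact ⟨∅, by simp, rfl, 0, k₀, 0, h0, subset_rfl, by simp⟩
    | succ j ih =>
      obtain ⟨D, hDn, hcard, p, k, d, hp, hsub, hD⟩ := ih
      obtain ⟨c, hc, hcD, p', k', d', hp', hsub', hD'⟩ := exists_new_dead_colour cH cK hd hs hp
        (fun q hq hqk => hk₀ q (mem_dom_isFiniteS.2 hq) (hsub hqk)) hD
      exact ⟨insert c D, Finset.insert_subset (Finset.mem_range.2 hc) hDn,
        by rw [Finset.card_insert_of_notMem hcD, hcard], p', k', d', hp', hsub'.trans hsub, hD'⟩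
  obtain ⟨D, hDn, hcard, -⟩ := main (H 0 0 + 1)
  have := Finset.card_le_card hDn
  simp [hcard] at this

end Problem

theorem exists_answer_LPOJump (p : Baire) (hp : p ∈ LPOJump.dom) :
    ∃ c : Bool, ∀ q : Baire, q 0 = c.toNat → q ∈ LPOJump p := by
  obtain ⟨q₀, hb, l, hl, hlb, h⟩ := hp
  rcases h with ⟨h, -⟩ | ⟨h, -⟩
  · exact ⟨false, fun q hq => ⟨hb, l, hl, hlb, Or.inl ⟨h, hq⟩⟩⟩
  · exact ⟨true, fun q hq => ⟨hb, l, hl, hlb, Or.inr ⟨h, hq⟩⟩⟩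

/-! ### Computability of total functionals -/

/-- A total functional is computable if its restriction to finite sequences (continued by zeros) is
primitive recursive and the number of entries which it reads is a primitive recursive function of
the first two entries. -/
theorem computableFunctional_of_primrec {G : Baire → Baire} {u : ℕ → ℕ → ℕ → ℕ}
    (hu : Primrec fun x : ℕ × ℕ × ℕ => u x.1 x.2.1 x.2.2)
    (hG : Primrec₂ fun (w : List ℕ) (n : ℕ) => G (fun j => w.getD j 0) n)
    (h : ∀ p q n, p 0 = q 0 → p 1 = q 1 → (∀ j < u (p 0) (p 1) n, p j = q j) → G p n = G q n) :
    ComputableFunctional fun p => Part.some (G p) := by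
  -- The lower bound 2 guarantees that both entries on which `u` depends have really been read.
  refine ⟨fun w n => if max 2 (u (w.getD 0 0) (w.getD 1 0) n) ≤ w.length then
    some (G (fun j => w.getD j 0) n) else none, ?_, ?_⟩
  · refine Primrec₂.to_comp (Primrec.ite ?_ (Primrec.option_some.comp hG) (Primrec.const none))
    have hget (i : ℕ) : Primrec fun x : List ℕ × ℕ => x.1.getD i 0 :=
      (Primrec.list_getD 0).comp Primrec.fst (Primrec.const i)
    exact Primrec.nat_le.comp
      (Primrec.nat_max.comp (Primrec.const 2)
        (hu.comp ((hget 0).pair ((hget 1).pair Primrec.snd))))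
      (Primrec.list_length.comp Primrec.fst)
  · rintro p _ ⟨-, rfl⟩ n
    have hget (k j : ℕ) (hj : j < k) : (pre p k).getD j 0 = p j := by
      simp [pre, hj]
    have hlen (k : ℕ) : (pre p k).length = k := by simp [pre]
    have key (k : ℕ) (hk : 2 ≤ k) (hu' : u (p 0) (p 1) n ≤ k) :
        G (fun j => (pre p k).getD j 0) n = G p n :=
      (h p (fun j => (pre p k).getD j 0) n (hget k 0 (by omega)).symm (hget k 1 (by omega)).symm
        fun j hj => (hget k j (hj.trans_le hu')).symm).symm
    refine ⟨⟨max 2 (u (p 0) (p 1) n), ?_⟩, fun k m hm => ?_⟩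
    · simp only [hlen]
      rw [hget _ 0 (by omega), hget _ 1 (by omega), if_pos le_rfl,
        key _ (le_max_left _ _) (le_max_right _ _)]
      rfl
    · simp only [hlen] at hm
      split_ifs at hm with hk
      have h2 : 2 ≤ k := (le_max_left _ _).trans hk
      rw [hget k 0 (by omega), hget k 1 (by omega)] at hk
      rw [key k h2 ((le_max_right _ _).trans hk)] at hm
      exact (Option.some.inj hm).symm

theorem primrec_getD {α : Type*} [Primcodable α] {w : α → List ℕ} {j : α → ℕ} (hw : Primrec w)
    (hj : Primrec j) : Primrec fun a => (w a).getD (j a) 0 :=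
  (Primrec.list_getD 0).comp hw hj

theorem computableFunctional_tuple {N : ℕ → ℕ → ℕ} {c : Baire → ℕ → Baire}
    {u : ℕ → ℕ → ℕ → ℕ → ℕ} (hN : Primrec₂ N)
    (hu : Primrec fun x : (ℕ × ℕ) × ℕ × ℕ => u x.1.1 x.1.2 x.2.1 x.2.2)
    (hc : Primrec fun x : List ℕ × ℕ × ℕ => c (fun j => x.1.getD j 0) x.2.1 x.2.2)
    (h : ∀ p q i k, p 0 = q 0 → p 1 = q 1 → (∀ j < u (p 0) (p 1) i k, p j = q j) →
      c p i k = c q i k) :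
    ComputableFunctional fun p => Part.some (tuple (N (p 0) (p 1)) (c p)) := by
  refine computableFunctional_of_primrec
    (u := fun a b n => u a b (n - 1).unpair.1 (n - 1).unpair.2) ?_ ?_ ?_
  · have h1 : Primrec fun x : ℕ × ℕ × ℕ => (x.2.2 - 1).unpair :=
      Primrec.unpair.comp (Primrec.pred.comp (Primrec.snd.comp Primrec.snd))
    exact hu.comp ((Primrec.fst.pair (Primrec.fst.comp Primrec.snd)).pair h1)
  · have h1 : Primrec fun x : List ℕ × ℕ => (x.2 - 1).unpair :=
      Primrec.unpair.comp (Primrec.pred.comp Primrec.snd)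
    exact Primrec.ite (Primrec.eq.comp Primrec.snd (Primrec.const 0))
      (hN.comp (primrec_getD Primrec.fst (Primrec.const 0))
        (primrec_getD Primrec.fst (Primrec.const 1)))
      (hc.comp (Primrec.fst.pair h1))
  · intro p q n h0 h1 hj
    simp only [tuple, h0, h1]
    rw [h p q _ _ h0 h1 hj]

/-- The functional which reads the entry `v n` of its argument. -/
theorem computableFunctional_read {v : ℕ → ℕ} (hv : Primrec v) :
    ComputableFunctional fun p => Part.some fun n => p (v n) := by
  refine computableFunctional_of_primrec (u := fun _ _ n => v n + 1)
    (Primrec.succ.comp (hv.comp (Primrec.snd.comp Primrec.snd)))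
    (primrec_getD Primrec.fst (hv.comp Primrec.snd)) fun p q n _ _ h => h _ (Nat.lt_succ_self _)

/-! ### Reductions by total functionals, and products -/

namespace Problem

theorem reducible_of_total {g f : Problem} {H K : Baire → Baire}
    (hH : ComputableFunctional fun p => Part.some (H p))
    (hK : ComputableFunctional fun p => Part.some (K p))
    (h : ∀ p ∈ g.dom, H p ∈ f.dom ∧ ∀ y ∈ f (H p), K (pairing y p) ∈ g p) : Reducible g f := by
  refine ⟨_, _, hH, hK, fun F hF p hp => ?_⟩
  obtain ⟨hd, hs⟩ := h p hp
  obtain ⟨y, hy, hyf⟩ := hF _ hd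
  exact ⟨_, Part.mem_bind_iff.2 ⟨_, Part.mem_some _, Part.mem_bind_iff.2
    ⟨y, hy, Part.mem_some _⟩⟩, hs y hyf⟩

/-- The zero sequence names the empty tuple, which serves as a computable dummy instance for the
other factor of a product. -/
theorem zero_mem_dom_finPar (f : Problem) : (0 : Baire) ∈ (finPar f).dom :=
  ⟨0, rfl, fun i hi => by simp at hi⟩

theorem primrec_mul_const (c : ℕ) : Primrec fun n : ℕ => c * n :=
  Primrec.nat_mul.comp (Primrec.const c) Primrec.id

theorem primrec_half : Primrec fun x : ℕ => x / 2 :=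
  Primrec.nat_div.comp Primrec.id (Primrec.const 2)

theorem primrecPred_even : PrimrecPred fun x : ℕ => x % 2 = 0 :=
  Primrec.eq.comp (Primrec.nat_mod.comp Primrec.id (Primrec.const 2)) (Primrec.const 0)

theorem reducible_prod_left {f g : Problem} (hg : (0 : Baire) ∈ g.dom) :
    Reducible f (prod f g) := by
  -- In `pairing y p` the solution `y` sits on even positions, and its first part on the even
  -- positions of `y`.
  refine reducible_of_total (H := fun p => pairing p 0) (K := fun r n => r (4 * n)) ?_
    (computableFunctional_read (primrec_mul_const 4)) fun p hp => ⟨?_, fun y hy => ?_⟩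
  · refine computableFunctional_of_primrec (u := fun _ _ n => n / 2 + 1)
      (Primrec.succ.comp (primrec_half.comp (Primrec.snd.comp Primrec.snd)))
      (Primrec.ite (primrecPred_even.comp Primrec.snd)
        (primrec_getD Primrec.fst (primrec_half.comp Primrec.snd)) (Primrec.const 0))
      fun p q n _ _ h => ?_
    simp [pairing, h (n / 2) (Nat.lt_succ_self _)]
  · obtain ⟨y, hy⟩ := hp
    obtain ⟨z, hz⟩ := hg
    exact ⟨pairing y z, by simpa, by simpa⟩
  · have : (fun n => pairing y p (4 * n)) = fstPart y := by
      funext n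
      simp [pairing, fstPart, show 4 * n % 2 = 0 by omega, show 4 * n / 2 = 2 * n by omega]
    rw [this]
    simpa using hy.1

theorem reducible_prod_right {f g : Problem} (hf : (0 : Baire) ∈ f.dom) :
    Reducible g (prod f g) := by
  refine reducible_of_total (H := fun p => pairing 0 p) (K := fun r n => r (4 * n + 2)) ?_
    (computableFunctional_read (Primrec.nat_add.comp (primrec_mul_const 4) (Primrec.const 2)))
    fun p hp => ⟨?_, fun y hy => ?_⟩
  · refine computableFunctional_of_primrec (u := fun _ _ n => n / 2 + 1)
      (Primrec.succ.comp (primrec_half.comp (Primrec.snd.comp Primrec.snd)))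
      (Primrec.ite (primrecPred_even.comp Primrec.snd) (Primrec.const 0)
        (primrec_getD Primrec.fst (primrec_half.comp Primrec.snd)))
      fun p q n _ _ h => ?_
    simp [pairing, h (n / 2) (Nat.lt_succ_self _)]
  · obtain ⟨y, hy⟩ := hp
    obtain ⟨z, hz⟩ := hf
    exact ⟨pairing z y, by simpa, by simpa⟩
  · have : (fun n => pairing y p (4 * n + 2)) = sndPart y := by
      funext n
      simp [pairing, sndPart, show (4 * n + 2) % 2 = 0 by omega,
        show (4 * n + 2) / 2 = 2 * n + 1 by omega]
    rw [this]
    simpa using hy.2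

/-- The functional which reads the first entry of the first component of a solution. -/
theorem computableFunctional_first_answer :
    ComputableFunctional fun r => Part.some fun _ => r (2 * (Nat.pair 0 0 + 1)) :=
  computableFunctional_read (Primrec.const _)

theorem pairing_first_answer (y p : Baire) :
    pairing y p (2 * (Nat.pair 0 0 + 1)) = component y 0 0 := by
  simp [pairing, component]

end Problem

/-! ### Closed choice reduces to `finPar TCN` -/

theorem dom_finPar_TCN (p : Baire) : p ∈ (finPar TCN).dom := by
  classical
  have : ∀ i, ∃ n, n ∉ enumerated (component p i) ∨ enumerated (component p i) = Set.univ :=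
    fun i => by
      by_cases h : enumerated (component p i) = Set.univ
      · exact ⟨0, Or.inr h⟩
      · obtain ⟨n, hn⟩ := (Set.ne_univ_iff_exists_notMem _).1 h
        exact ⟨n, Or.inl hn⟩
  choose c hc using this
  refine ⟨tuple (p 0) fun i _ => c i, rfl, fun i _ => ?_⟩
  rw [component_tuple]
  exact hc i

theorem reducible_CN_finPar_TCN : Reducible CN (finPar TCN) := by
  refine reducible_of_total (H := fun e => tuple 1 fun _ => e) ?_
    computableFunctional_first_answer fun e he => ⟨dom_finPar_TCN _, fun y hy => ?_⟩
  · exact computableFunctional_tuple (N := fun _ _ => 1) (u := fun _ _ _ k => k + 1)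
      (Primrec₂.const 1) (Primrec.succ.comp (Primrec.snd.comp Primrec.snd))
      (primrec_getD Primrec.fst (Primrec.snd.comp Primrec.snd))
      fun p q i k _ _ h => h k (Nat.lt_succ_self k)
  · have h := hy.2 0 (by simp)
    rw [component_tuple] at h
    obtain ⟨z, hz⟩ := he
    change pairing y e (2 * (Nat.pair 0 0 + 1)) ∉ enumerated e
    rw [pairing_first_answer]
    exact h.resolve_right fun h => hz (by simp [h])

/-! ### Finiteness reduces to `finPar LPOJump` -/

/-- The entry at `Nat.pair i s` of this sequence says whether no one occurs in `p` at the positions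
from `i` to `s - 1`. -/
def noOnes (p : Baire) : Baire := fun x =>
  if ∃ k ∈ List.range x.unpair.2, x.unpair.1 ≤ k ∧ p k = 1 then 0 else 1

open Classical in
/-- The limits of the sequences which `noOnes p` consists of. -/
noncomputable def noOnesLimit (p : Baire) : Baire := fun i => if ∃ k ≥ i, p k = 1 then 0 else 1

theorem tendsto_noOnes (p : Baire) (i : ℕ) :
    Filter.Tendsto (fun s => noOnes p (Nat.pair i s)) Filter.atTop (nhds (noOnesLimit p i)) := by
  refine tendsto_nhds_of_eventually_eq ?_
  by_cases h : ∃ k ≥ i, p k = 1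
  · obtain ⟨k, hk, hk1⟩ := h
    filter_upwards [Filter.eventually_gt_atTop k] with s hs
    rw [noOnesLimit, if_pos ⟨k, hk, hk1⟩, noOnes, if_pos]
    exact ⟨k, by simpa using hs, by simpa using hk, hk1⟩
  · refine Filter.Eventually.of_forall fun s => ?_
    rw [noOnesLimit, if_neg h, noOnes, if_neg]
    rintro ⟨k, -, hk, hk1⟩
    exact h ⟨k, by simpa using hk, hk1⟩

theorem noOnesLimit_eq_zero_iff (p : Baire) : noOnesLimit p = 0 ↔ ¬ {k | p k = 1}.Finite := by
  rw [funext_iff, ← Set.Infinite, Set.infinite_iff_exists_gt]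
  simp only [noOnesLimit, Pi.zero_apply, ite_eq_left_iff, one_ne_zero, imp_false, not_not,
    Set.mem_ofPred_eq]
  refine ⟨fun h i => ?_, fun h i => ?_⟩
  · obtain ⟨k, hk, hk1⟩ := h (i + 1)
    exact ⟨k, hk1, hk⟩
  · obtain ⟨k, hk1, hk⟩ := h i
    exact ⟨k, hk.le, hk1⟩

theorem LPOJump_noOnes (p q : Baire) : q ∈ LPOJump (noOnes p) ↔
    ({k | p k = 1}.Finite ∧ q 0 = 1) ∨ (¬ {k | p k = 1}.Finite ∧ q 0 = 0) := by
  have hb : IsBinary (noOnes p) := fun k => by unfold noOnes; split_ifs <;> norm_num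
  have hbl : IsBinary (noOnesLimit p) := fun k => by unfold noOnesLimit; split_ifs <;> norm_num
  have : q ∈ LPOJump (noOnes p) ↔ q ∈ LPO (noOnesLimit p) := by
    refine ⟨fun ⟨_, l, hl, hq⟩ => ?_, fun h => ⟨hb, _, tendsto_noOnes p, h⟩⟩
    obtain rfl : l = noOnesLimit p :=
      funext fun i => tendsto_nhds_unique (hl i) (tendsto_noOnes p i)
    exact hq
  rw [this]
  simp only [LPO, Set.mem_ofPred_eq, hbl, true_and, ne_eq, noOnesLimit_eq_zero_iff, not_not]
  exact or_comm

theorem computableFunctional_noOnes :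
    ComputableFunctional fun p => Part.some (tuple 1 fun _ => noOnes p) := by
  refine computableFunctional_tuple (N := fun _ _ => 1) (c := fun p _ => noOnes p)
    (u := fun _ _ _ k => k.unpair.2)
    (Primrec₂.const 1) ?_ (Primrec.ite ?_ (Primrec.const 0) (Primrec.const 1))
    fun p q i k _ _ h => ?_
  · exact Primrec.snd.comp (Primrec.unpair.comp (Primrec.snd.comp Primrec.snd))
  · have hu : Primrec fun x : List ℕ × ℕ × ℕ => x.2.2.unpair :=
      Primrec.unpair.comp (Primrec.snd.comp Primrec.snd)
    have hR : PrimrecRel fun (k : ℕ) (x : List ℕ × ℕ × ℕ) =>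
        x.2.2.unpair.1 ≤ k ∧ x.1.getD k 0 = 1 :=
      PrimrecPred.and
        (Primrec.nat_le.comp (Primrec.fst.comp (hu.comp Primrec.snd)) Primrec.fst)
        (Primrec.eq.comp (primrec_getD (Primrec.fst.comp Primrec.snd) Primrec.fst)
          (Primrec.const 1))
    exact hR.exists_mem_list.comp (Primrec.list_range.comp (Primrec.snd.comp hu)) Primrec.id
  · have : (∃ j ∈ List.range k.unpair.2, k.unpair.1 ≤ j ∧ p j = 1) ↔
        ∃ j ∈ List.range k.unpair.2, k.unpair.1 ≤ j ∧ q j = 1 :=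
      exists_congr fun j => and_congr_right fun hj => by rw [h j (List.mem_range.1 hj)]
    simp only [noOnes, this]

theorem reducible_isFiniteS_finPar_LPOJump : Reducible IsFiniteS (finPar LPOJump) := by
  classical
  refine reducible_of_total computableFunctional_noOnes computableFunctional_first_answer
    fun p hp => ⟨?_, fun y hy => ?_⟩
  · refine ⟨tuple 1 fun _ _ => if {k | p k = 1}.Finite then 1 else 0, rfl, fun i _ => ?_⟩
    rw [component_tuple, component_tuple, LPOJump_noOnes]
    by_cases h : {k | p k = 1}.Finite <;> simp [h]
  · have h := hy.2 0 (by simp)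
    rw [component_tuple, LPOJump_noOnes] at h
    have hb := mem_dom_isFiniteS.1 hp
    simp only [pairing_first_answer]
    rcases h with ⟨hf, h1⟩ | ⟨hf, h0⟩
    · exact ⟨hb, fun _ => by simp [h1], by simpa [h1] using hf⟩
    · exact ⟨hb, fun _ => by simp [h0], by simpa [h0] using hf⟩

/-! ### From `finPar TCN` to `ECT` -/

/-- After `s` steps of the enumeration `e`, a number which may have not been enumerated: it is
increased whenever it is found to have been listed. -/
def candidate (e : Baire) (s : ℕ) : ℕ :=
  s.rec 0 fun s c => if ∃ k ∈ List.range (s + 1), e k = c + 1 then c + 1 else c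

theorem candidate_succ (e : Baire) (s : ℕ) : candidate e (s + 1) =
    if ∃ k ∈ List.range (s + 1), e k = candidate e s + 1 then candidate e s + 1
    else candidate e s := rfl

theorem candidate_congr {e e' : Baire} {s : ℕ} (h : ∀ k < s, e k = e' k) :
    candidate e s = candidate e' s := by
  induction s with
  | zero => rfl
  | succ s ih =>
    have : (∃ k ∈ List.range (s + 1), e k = candidate e' s + 1) ↔
        ∃ k ∈ List.range (s + 1), e' k = candidate e' s + 1 :=
      exists_congr fun k => and_congr_right fun hk => by rw [h k (List.mem_range.1 hk)]
    simp only [candidate_succ, ih fun k hk => h k (hk.trans (Nat.lt_succ_self s)), this]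

theorem candidate_mono (e : Baire) : Monotone (candidate e) :=
  monotone_nat_of_le_succ fun s => by rw [candidate_succ]; split_ifs <;> omega

theorem candidate_le {e : Baire} {n : ℕ} (hn : n ∉ enumerated e) (s : ℕ) : candidate e s ≤ n := by
  induction s with
  | zero => exact Nat.zero_le _
  | succ s ih =>
    rw [candidate_succ]
    split_ifs with h
    · obtain ⟨k, -, hk⟩ := h
      exact lt_of_le_of_ne ih fun h => hn ⟨k, by rw [hk, h]⟩
    · exact ih

theorem candidate_eventually_const {e : Baire} (h : enumerated e ≠ Set.univ) :
    ∃ N, ∀ s ≥ N, candidate e s = candidate e N := by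
  obtain ⟨n, hn⟩ := (Set.ne_univ_iff_exists_notMem _).1 h
  by_contra! hcon
  have (m : ℕ) : ∃ s, m ≤ candidate e s := by
    induction m with
    | zero => exact ⟨0, Nat.zero_le _⟩
    | succ m ih =>
      obtain ⟨s, hs⟩ := ih
      obtain ⟨t, ht, hne⟩ := hcon s
      exact ⟨t, hs.trans_lt (lt_of_le_of_ne (candidate_mono e ht) hne.symm)⟩
  obtain ⟨s, hs⟩ := this (n + 1)
  exact (candidate_le hn s).not_gt hs

/-- Were the final candidate listed at step `k`, it would be increased at step `max N k`. -/
theorem candidate_notMem {e : Baire} {N : ℕ} (h : ∀ s ≥ N, candidate e s = candidate e N) :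
    candidate e N ∉ enumerated e := by
  rintro ⟨k, hk⟩
  have h1 := h (max N k) (le_max_left _ _)
  have h2 := h (max N k + 1) ((le_max_left _ _).trans (Nat.le_succ _))
  rw [candidate_succ, if_pos, h1] at h2
  · omega
  · exact ⟨k, List.mem_range.2 (Nat.lt_succ_of_le (le_max_right _ _)), by rw [h1, hk]⟩

theorem primrec_candidate {α : Type*} [Primcodable α] {e : α → Baire} {s : α → ℕ}
    (he : Primrec₂ e) (hs : Primrec s) : Primrec fun a => candidate (e a) (s a) := by
  refine Primrec.nat_rec' hs (Primrec.const 0)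
    (h := fun a x => if ∃ k ∈ List.range (x.1 + 1), e a k = x.2 + 1 then x.2 + 1 else x.2) ?_
  have hx : Primrec fun y : α × ℕ × ℕ => y.2.2 := Primrec.snd.comp Primrec.snd
  have hR : PrimrecRel fun (k : ℕ) (y : α × ℕ × ℕ) => e y.1 k = y.2.2 + 1 :=
    Primrec.eq.comp (he.comp (Primrec.fst.comp Primrec.snd) Primrec.fst)
      (Primrec.succ.comp (hx.comp Primrec.snd))
  exact Primrec.ite (hR.exists_mem_list.comp (Primrec.list_range.comp
    (Primrec.succ.comp (Primrec.fst.comp Primrec.snd))) Primrec.id) (Primrec.succ.comp hx) hx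

theorem ect_recurrent {p q : Baire} (hq : q ∈ ECT p) {x : ℕ} (hx : q 0 < x) (z : ℕ) :
    ∃ y > z, p (y + 1) = p (x + 1) := by
  induction z with
  | zero =>
    obtain ⟨y, hy, h⟩ := hq.2 x hx
    exact ⟨y, by omega, h.symm⟩
  | succ z ih =>
    obtain ⟨y, hy, h⟩ := ih
    rcases le_or_gt y (q 0) with hyq | hyq
    · exact ⟨max x (z + 2), by omega, by
        have : max x (z + 2) = x := by omega
        rw [this]⟩
    · obtain ⟨y', hy', h'⟩ := hq.2 y hyq
      exact ⟨y', by omega, h'.symm.trans h⟩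

/-- Each colour has a bound past its last occurrence, if there is one; the palette is finite, so the
supremum of these bounds works. -/
theorem mem_dom_ECT {p : Baire} : p ∈ ECT.dom ↔ ∀ k, p (k + 1) < p 0 := by
  refine ⟨fun ⟨_, h, _⟩ => h, fun h => ?_⟩
  have : ∀ c, ∃ b, ∀ x > b, p (x + 1) = c → ∃ y > x, p (y + 1) = c := fun c => by
    by_contra! hcon
    obtain ⟨x, hx, hxc, hx'⟩ := hcon 0
    obtain ⟨y, hy, hyc, -⟩ := hcon x
    exact hx' y hy hyc
  choose b hb using this
  refine ⟨fun _ => (Finset.range (p 0)).sup b, h, fun x hx => ?_⟩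
  obtain ⟨y, hy, hyc⟩ := hb (p (x + 1)) x
    ((Finset.le_sup (f := b) (Finset.mem_range.2 (h x))).trans_lt hx) rfl
  exact ⟨y, hy, hyc.symm⟩

/-- The colouring which shows at `x` whether the candidate of the component `x % p 0` changes
between the steps `x` and `x + p 0`. -/
def changeColouring (p : Baire) : Baire := fun x =>
  if x = 0 then p 0 + 1
  else if candidate (component p ((x - 1) % p 0)) (x - 1) =
    candidate (component p ((x - 1) % p 0)) (x - 1 + p 0) then 0 else (x - 1) % p 0 + 1

theorem changeColouring_succ (p : Baire) (x : ℕ) : changeColouring p (x + 1) =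
    if candidate (component p (x % p 0)) x = candidate (component p (x % p 0)) (x + p 0) then 0
    else x % p 0 + 1 := rfl

theorem changeColouring_mem_dom (p : Baire) : changeColouring p ∈ ECT.dom := by
  refine mem_dom_ECT.2 fun k => ?_
  rw [changeColouring_succ]
  change _ < p 0 + 1
  split_ifs with h
  · exact Nat.succ_pos _
  · refine Nat.succ_lt_succ (Nat.mod_lt _ (Nat.pos_of_ne_zero fun h0 => h ?_))
    rw [h0, add_zero]

/-- A change after the bound would show colour `i + 1`, which then recurs arbitrarily late, although
the candidate eventually stabilizes. So the candidate is constant along the residue class of `i`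
past the bound, and by monotonicity constant from there on. -/
theorem candidate_notMem_of_ect {p y : Baire} (hy : y ∈ ECT (changeColouring p)) {i : ℕ}
    (hi : i < p 0) (hA : enumerated (component p i) ≠ Set.univ) :
    candidate (component p i) ((y 0 + 1) * p 0 + i) ∉ enumerated (component p i) := by
  obtain ⟨N, hN⟩ := candidate_eventually_const hA
  have step (x : ℕ) (hx : y 0 < x) (hxi : x % p 0 = i) :
      candidate (component p i) x = candidate (component p i) (x + p 0) := by
    by_contra hne
    obtain ⟨z, hz, hzx⟩ := ect_recurrent hy hx N
    rw [changeColouring_succ, changeColouring_succ, hxi, if_neg hne] at hzx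
    split_ifs at hzx with h
    rw [Nat.succ.inj hzx, hN z hz.le, hN (z + p 0) (by omega)] at h
    exact h rfl
  set s := (y 0 + 1) * p 0 + i
  have hs : y 0 < s := by
    have : y 0 + 1 ≤ (y 0 + 1) * p 0 := Nat.le_mul_of_pos_right _ (by omega)
    omega
  have hsi : s % p 0 = i := by
    rw [show s = i + (y 0 + 1) * p 0 from add_comm _ _, Nat.add_mul_mod_self_right,
      Nat.mod_eq_of_lt hi]
  have const (j : ℕ) : candidate (component p i) (s + j * p 0) = candidate (component p i) s := by
    induction j with
    | zero => simp
    | succ j ih =>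
      rw [← ih, step (s + j * p 0) (by omega) (by rw [Nat.add_mul_mod_self_right, hsi])]
      congr 1
      ring
  refine candidate_notMem fun t ht => le_antisymm ?_ (candidate_mono _ ht)
  rw [← const t]
  exact candidate_mono _ ((Nat.le_mul_of_pos_right t (by omega)).trans (Nat.le_add_left _ _))

theorem computableFunctional_changeColouring :
    ComputableFunctional fun p => Part.some (changeColouring p) := by
  refine computableFunctional_of_primrec
    (u := fun a _ x => Nat.pair ((x - 1) % a) (x - 1 + a) + 1) ?_ ?_ ?_
  · have hx : Primrec fun x : ℕ × ℕ × ℕ => x.2.2 - 1 :=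
      Primrec.pred.comp (Primrec.snd.comp Primrec.snd)
    exact Primrec.succ.comp (Primrec₂.natPair.comp (Primrec.nat_mod.comp hx Primrec.fst)
      (Primrec.nat_add.comp hx Primrec.fst))
  · have hx : Primrec fun x : List ℕ × ℕ => x.2 - 1 := Primrec.pred.comp Primrec.snd
    have h0 : Primrec fun x : List ℕ × ℕ => x.1.getD 0 0 :=
      primrec_getD Primrec.fst (Primrec.const 0)
    have hm : Primrec fun x : List ℕ × ℕ => (x.2 - 1) % x.1.getD 0 0 :=
      Primrec.nat_mod.comp hx h0
    have he : Primrec₂ fun (x : List ℕ × ℕ) (k : ℕ) =>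
        component (fun j => x.1.getD j 0) ((x.2 - 1) % x.1.getD 0 0) k :=
      primrec_getD (Primrec.fst.comp Primrec.fst)
        (Primrec.succ.comp (Primrec₂.natPair.comp (hm.comp Primrec.fst) Primrec.snd))
    exact Primrec.ite (Primrec.eq.comp Primrec.snd (Primrec.const 0)) (Primrec.succ.comp h0)
      (Primrec.ite (Primrec.eq.comp (primrec_candidate he hx)
        (primrec_candidate he (Primrec.nat_add.comp hx h0))) (Primrec.const 0)
        (Primrec.succ.comp hm))
  · intro p q x h0 _ h
    have hc (k : ℕ) (hk : k < x - 1 + p 0) :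
        component p ((x - 1) % p 0) k = component q ((x - 1) % p 0) k :=
      h _ (Nat.succ_lt_succ (Nat.pair_lt_pair_right _ hk))
    simp only [changeColouring, ← h0]
    rw [candidate_congr hc, candidate_congr fun k hk => hc k (by omega)]

/-- The functional which reads off the candidates at a bound `r 0` for the colouring. -/
def readCandidates (r : Baire) : Baire := tuple (r 1) fun i _ =>
  candidate (component (sndPart r) i) ((r 0 + 1) * r 1 + i)

/-- On `pairing y p` the first two entries are `y 0` and `p 0`, which is all that is needed to bound
the positions read. -/
theorem computableFunctional_readCandidates :
    ComputableFunctional fun r => Part.some (readCandidates r) := by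
  refine computableFunctional_tuple (N := fun _ b => b)
    (u := fun a b i _ => 2 * (Nat.pair i ((a + 1) * b + i) + 1) + 1) Primrec₂.right ?_ ?_ ?_
  · have hi : Primrec fun x : (ℕ × ℕ) × ℕ × ℕ => x.2.1 := Primrec.fst.comp Primrec.snd
    have ha : Primrec fun x : (ℕ × ℕ) × ℕ × ℕ => x.1.1 := Primrec.fst.comp Primrec.fst
    have hb : Primrec fun x : (ℕ × ℕ) × ℕ × ℕ => x.1.2 := Primrec.snd.comp Primrec.fst
    exact Primrec.nat_double_succ.comp (Primrec.succ.comp (Primrec₂.natPair.comp hi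
      (Primrec.nat_add.comp (Primrec.nat_mul.comp (Primrec.succ.comp ha) hb) hi)))
  · have hi : Primrec fun x : List ℕ × ℕ × ℕ => x.2.1 := Primrec.fst.comp Primrec.snd
    have hget (i : ℕ) : Primrec fun x : List ℕ × ℕ × ℕ => x.1.getD i 0 :=
      primrec_getD Primrec.fst (Primrec.const i)
    have he : Primrec₂ fun (x : List ℕ × ℕ × ℕ) (k : ℕ) =>
        component (sndPart fun j => x.1.getD j 0) x.2.1 k :=
      primrec_getD (Primrec.fst.comp Primrec.fst) (Primrec.nat_double_succ.comp
        (Primrec.succ.comp (Primrec₂.natPair.comp (hi.comp Primrec.fst) Primrec.snd)))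
    exact primrec_candidate he (Primrec.nat_add.comp
      (Primrec.nat_mul.comp (Primrec.succ.comp (hget 0)) (hget 1)) hi)
  · intro p q i k h0 h1 h
    simp only [← h0, ← h1]
    refine candidate_congr fun k hk => h _ ?_
    have := Nat.pair_lt_pair_right i hk
    omega

theorem reducible_finPar_TCN_ECT : Reducible (finPar TCN) ECT := by
  refine reducible_of_total computableFunctional_changeColouring
    computableFunctional_readCandidates fun p _ => ⟨changeColouring_mem_dom p, fun y hy => ?_⟩
  refine ⟨rfl, fun i hi => ?_⟩
  rw [readCandidates, component_tuple, sndPart_pairing]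
  by_cases hA : enumerated (component p i) = Set.univ
  · exact Or.inr hA
  · exact Or.inl (candidate_notMem_of_ect hy hi hA)

/-! ### From `ECT` to `finPar TCN` -/

/-- The component `i` enumerates the numbers after which the colour `i` occurs. -/
def occurrences (p : Baire) : Baire := tuple (p 0) fun i k =>
  if p (k.unpair.1 + 1) = i ∧ k.unpair.2 < k.unpair.1 then k.unpair.2 + 1 else 0

theorem mem_enumerated_occurrences {p : Baire} {i b : ℕ} :
    b ∈ enumerated (component (occurrences p) i) ↔ ∃ x > b, p (x + 1) = i := by
  rw [occurrences, component_tuple]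
  constructor
  · rintro ⟨k, hk⟩
    dsimp only at hk
    split_ifs at hk with h
    obtain rfl := Nat.succ.inj hk
    exact ⟨_, h.2, h.1⟩
  · rintro ⟨x, hx, rfl⟩
    refine ⟨Nat.pair x b, ?_⟩
    simp [hx]

theorem computableFunctional_occurrences :
    ComputableFunctional fun p => Part.some (occurrences p) := by
  refine computableFunctional_tuple (N := fun a _ => a)
    (u := fun _ _ _ k => k.unpair.1 + 2) Primrec₂.left ?_ ?_ ?_
  · exact Primrec.succ.comp (Primrec.succ.comp
      (Primrec.fst.comp (Primrec.unpair.comp (Primrec.snd.comp Primrec.snd))))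
  · have hu : Primrec fun x : List ℕ × ℕ × ℕ => x.2.2.unpair :=
      Primrec.unpair.comp (Primrec.snd.comp Primrec.snd)
    have h1 := Primrec.fst.comp hu
    have h2 := Primrec.snd.comp hu
    exact Primrec.ite (PrimrecPred.and
      (Primrec.eq.comp (primrec_getD Primrec.fst (Primrec.succ.comp h1))
        (Primrec.fst.comp Primrec.snd)) (Primrec.nat_lt.comp h2 h1))
      (Primrec.succ.comp h2) (Primrec.const 0)
  · intro p q i k _ _ h
    simp only [h (k.unpair.1 + 1) (by omega)]

/-- The maximum of the first entries of the components `0, …, n - 1` of `q`. -/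
def maxAnswer (q : Baire) (n : ℕ) : ℕ := n.rec 0 fun i c => max c (component q i 0)

theorem le_maxAnswer (q : Baire) {n i : ℕ} (hi : i < n) : component q i 0 ≤ maxAnswer q n := by
  induction n with
  | zero => simp at hi
  | succ n ih =>
    change _ ≤ max (maxAnswer q n) (component q n 0)
    rcases Nat.lt_succ_iff_lt_or_eq.1 hi with h | rfl
    · exact (ih h).trans (le_max_left _ _)
    · exact le_max_right _ _

theorem maxAnswer_congr {q q' : Baire} {n : ℕ} (h : ∀ i < n, component q i 0 = component q' i 0) :
    maxAnswer q n = maxAnswer q' n := by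
  induction n with
  | zero => rfl
  | succ n ih =>
    change max (maxAnswer q n) (component q n 0) = max (maxAnswer q' n) (component q' n 0)
    rw [ih fun i hi => h i (hi.trans (Nat.lt_succ_self n)), h n (Nat.lt_succ_self n)]

theorem computableFunctional_maxAnswer :
    ComputableFunctional fun r => Part.some fun _ => maxAnswer (fstPart r) (r 1) := by
  refine computableFunctional_of_primrec
    (u := fun _ b _ => 2 * (Nat.pair b 0 + 1) + 1) ?_ ?_ ?_
  · exact Primrec.nat_double_succ.comp (Primrec.succ.comp (Primrec₂.natPair.comp
      (Primrec.fst.comp Primrec.snd) (Primrec.const 0)))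
  · refine Primrec.nat_rec' (primrec_getD Primrec.fst (Primrec.const 1)) (Primrec.const 0)
      (h := fun (a : List ℕ × ℕ) (x : ℕ × ℕ) =>
        max x.2 (component (fstPart fun j => a.1.getD j 0) x.1 0)) ?_
    exact Primrec.nat_max.comp (Primrec.snd.comp Primrec.snd)
      (primrec_getD (Primrec.fst.comp Primrec.fst) (Primrec.nat_double.comp (Primrec.succ.comp
        (Primrec₂.natPair.comp (Primrec.fst.comp Primrec.snd) (Primrec.const 0)))))
  · intro p q n _ h1 h
    rw [← h1]
    refine maxAnswer_congr fun i hi => h _ ?_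
    have := Nat.pair_lt_pair_left 0 hi
    omega

/-- If a colour occurs beyond the maximal answer, the answer for that colour was enumerated. It can
be correct only because everything is enumerated, i.e. because the colour occurs infinitely often.
-/
theorem reducible_ECT_finPar_TCN : Reducible ECT (finPar TCN) := by
  refine reducible_of_total computableFunctional_occurrences computableFunctional_maxAnswer
    fun p hp => ⟨dom_finPar_TCN _, fun y hy => ?_⟩
  have hlt := mem_dom_ECT.1 hp
  refine ⟨hlt, fun x hx => ?_⟩
  rw [fstPart_pairing] at hx
  change maxAnswer y (p 0) < x at hx
  rcases hy.2 (p (x + 1)) (hlt x) with h | h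
  · exact (h (mem_enumerated_occurrences.2
      ⟨x, (le_maxAnswer y (hlt x)).trans_lt hx, rfl⟩)).elim
  · obtain ⟨z, hz, hzx⟩ := mem_enumerated_occurrences.1 (h ▸ Set.mem_univ x)
    exact ⟨z, hz, hzx.symm⟩

/-! ### Incomparability and the main theorem -/

theorem not_topReducible_finPar_LPOJump_finPar_TCN :
    ¬ TopReducible (finPar LPOJump) (finPar TCN) := fun h =>
  not_topReducible_isFiniteS_ECT ((reducible_isFiniteS_finPar_LPOJump.topReducible.trans h).trans
    reducible_finPar_TCN_ECT.topReducible)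

theorem not_topReducible_finPar_TCN_finPar_LPOJump :
    ¬ TopReducible (finPar TCN) (finPar LPOJump) := fun h =>
  not_topReducible_CN_finPar exists_answer_LPOJump (reducible_CN_finPar_TCN.topReducible.trans h)

end Weihrauch

open Weihrauch Weihrauch.Problem in
theorem mainTheorem8 :
    Weihrauch.Problem.Incomparable
      (Weihrauch.Problem.finPar Weihrauch.LPOJump) (Weihrauch.Problem.finPar Weihrauch.TCN) ∧
    ¬ Weihrauch.Problem.Reducible Weihrauch.CN (Weihrauch.Problem.finPar Weihrauch.LPOJump) ∧
    ¬ Weihrauch.Problem.Reducible Weihrauch.IsFiniteS Weihrauch.ECT ∧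
    Weihrauch.Problem.Equivalent Weihrauch.ECT (Weihrauch.Problem.finPar Weihrauch.TCN) ∧
    Weihrauch.Problem.StrictlyBelow
      (Weihrauch.Problem.finPar Weihrauch.LPOJump)
      (Weihrauch.Problem.prod
        (Weihrauch.Problem.finPar Weihrauch.LPOJump) (Weihrauch.Problem.finPar Weihrauch.TCN)) ∧
    Weihrauch.Problem.StrictlyBelow
      (Weihrauch.Problem.finPar Weihrauch.TCN)
      (Weihrauch.Problem.prod
        (Weihrauch.Problem.finPar Weihrauch.LPOJump) (Weihrauch.Problem.finPar Weihrauch.TCN)) := by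
  have left := reducible_prod_left (f := finPar LPOJump) (zero_mem_dom_finPar TCN)
  have right := reducible_prod_right (g := finPar TCN) (zero_mem_dom_finPar LPOJump)
  exact ⟨⟨fun h => not_topReducible_finPar_LPOJump_finPar_TCN h.topReducible,
      fun h => not_topReducible_finPar_TCN_finPar_LPOJump h.topReducible⟩,
    fun h => not_topReducible_CN_finPar exists_answer_LPOJump h.topReducible,
    fun h => not_topReducible_isFiniteS_ECT h.topReducible,
    ⟨reducible_ECT_finPar_TCN, reducible_finPar_TCN_ECT⟩,
    ⟨left, fun h => not_topReducible_finPar_TCN_finPar_LPOJump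
      (right.topReducible.trans h.topReducible)⟩,
    ⟨right, fun h => not_topReducible_finPar_LPOJump_finPar_TCN
      (left.topReducible.trans h.topReducible)⟩⟩
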